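/- For $\alpha,\beta>0$ and an integer $n\ge 2$, the dynamic Erdős–Rényi graph $\{G(t)\}_{t\ge 0}$ on $n$ vertices is the random graph process in which, independently for each pair of distinct vertices, the state of the pair (edge present or absent) is updated at the points of a Poisson process with intensity $\alpha+\frac{\beta}{n-1}$, and after each update, independently of the Poisson process and of all previous states, the edge is present with probability $\frac{\beta}{\beta+(n-1)\alpha}$ and absent otherwise. (Equivalently, an absent edge appears after an $\mathrm{Exp}(\frac{\beta}{n-1})$ time and a present edge disappears after an $\mathrm{Exp}(\alpha)$ time, independently over pairs.) It is called critical if $\alpha=\beta$. Let $\hat\tau(\epsilon n)$ be the first time at which the critical dynamic Erdős–Rényi graph on $n$ vertices, started with no edges, has a connected component with at least $\epsilon n$ vertices. Then there is a function $r$ with $r(x)=O(x^3)$ as $x\downarrow 0$, not depending on $n$, $\alpha$ or $\epsilon$, such that for every $\alpha=\beta>0$, every $0<\epsilon<1$ and every $\hat\epsilon>\epsilon$, $$\mathbb{E}[\hat\tau(\epsilon n)] = O(n^{-1/2})\, e^{\,n\left(\hat\epsilon^2/16+r(\hat\epsilon)\right)}\qquad (n\to\infty),$$ that is, there are $M<\infty$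 and $n_0$ (which may depend on $\alpha,\epsilon,\hat\epsilon$) such that $\mathbb{E}[\hat\tau(\epsilon n)]\le M n^{-1/2}e^{n(\hat\epsilon^2/16+r(\hat\epsilon))}$ for all $n\ge n_0$. -/

import Mathlib

open MeasureTheory ProbabilityTheory Filter Topology Asymptotics
open scoped NNReal ENNReal

namespace DynamicER

/-- `N` is a (homogeneous) Poisson process with intensity `rate`, given as a counting process:
`N t` is the number of points in the time interval `(0, t]`. -/
structure IsPoissonProcess {Ω : Type*} [MeasurableSpace Ω] (rate : ℝ≥0)
    (N : ℝ≥0 → Ω → ℕ) (μ : Measure Ω) : Prop where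
  measurable : ∀ t, Measurable (N t)
  zero : ∀ᵐ ω ∂μ, N 0 ω = 0
  monotone : ∀ᵐ ω ∂μ, Monotone fun t => N t ω
  right_continuous : ∀ᵐ ω ∂μ, ∀ t, ContinuousWithinAt (fun s => N s ω) (Set.Ici t) t
  increment_law : ∀ s t, s ≤ t →
    HasLaw (fun ω => N t ω - N s ω) (poissonMeasure (rate * (t - s))) μ
  indep_increments : HasIndepIncrements N μ

/-- Unordered pairs of distinct vertices among `n` vertices. -/
abbrev VertexPair (n : ℕ) : Type := {e : Sym2 (Fin n) // ¬ e.IsDiag}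

/-- The rate `α + β / (n - 1)` at which the state of a vertex pair is updated. -/
noncomputable def updateRate (α β : ℝ) (n : ℕ) : ℝ := α + β / ((n : ℝ) - 1)

/-- The probability `β / (β + (n - 1) α)` that the edge is present after an update. -/
noncomputable def edgeProb (α β : ℝ) (n : ℕ) : ℝ := β / (β + ((n : ℝ) - 1) * α)

/-- The state of a vertex pair after `m` updates: the initial state if `m = 0`, and otherwise the
result of the `m`-th (that is, the last) update.  The results of the successive updates are
`b 0, b 1, b 2, …`. -/
def stateAfter (init : Prop) (b : ℕ → Bool) : ℕ → Prop
  | 0 => init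
  | m + 1 => b m = true

/-- `G` is the dynamic Erdős–Rényi graph on `n` vertices with parameters `α`, `β`, started from
the graph `G₀`.  Independently for each vertex pair `e`, the state of `e` is updated at the points
of a Poisson process `N e` with intensity `α + β / (n - 1)`; independently of the Poisson process
and of the previous states, the edge is present after an update with probability
`β / (β + (n - 1) α)` and absent otherwise (`B e k` is the result of update number `k + 1`). -/
def IsDynamicERGraph {Ω : Type*} [MeasurableSpace Ω] (α β : ℝ) {n : ℕ}
    (G₀ : SimpleGraph (Fin n)) (G : ℝ≥0 → Ω → SimpleGraph (Fin n)) (μ : Measure Ω) : Prop :=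
  ∃ (N : VertexPair n → ℝ≥0 → Ω → ℕ) (B : VertexPair n → ℕ → Ω → Bool),
    (∀ e, IsPoissonProcess (updateRate α β n).toNNReal (N e) μ) ∧
    (∀ e k, Measurable (B e k)) ∧
    (∀ e k, μ {ω | B e k ω = true} = ENNReal.ofReal (edgeProb α β n)) ∧
    (∀ e, iIndepFun (B e) μ) ∧
    (∀ e, IndepFun (fun ω (t : ℝ≥0) => N e t ω) (fun ω (k : ℕ) => B e k ω) μ) ∧
    iIndepFun (fun e ω => ((fun t : ℝ≥0 => N e t ω), (fun k : ℕ => B e k ω))) μ ∧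
    ∀ᵐ ω ∂μ, ∀ t, ∀ e : VertexPair n,
      e.1 ∈ (G t ω).edgeSet ↔ stateAfter (e.1 ∈ G₀.edgeSet) (fun k => B e k ω) (N e t ω)

/-- The graph `H` has a connected component with at least `x` vertices. -/
def HasComponentOfSize {V : Type*} (H : SimpleGraph V) (x : ℝ) : Prop :=
  ∃ C : H.ConnectedComponent, x ≤ (C.supp.ncard : ℝ)

/-- The first time at which the graph process `G` has a component of size at least `x`
(infinite if there is no such time). -/
noncomputable def componentTime {Ω V : Type*} (G : ℝ≥0 → Ω → SimpleGraph V) (x : ℝ) (ω : Ω) :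
    ℝ≥0∞ :=
  ⨅ (t : ℝ≥0) (_ : HasComponentOfSize (G t ω) x), (t : ℝ≥0∞)

end DynamicER

/-! Cut time into blocks of a fixed length `T`. In a block, call a pair fresh if it is updated there
and its last update is positive. Fresh pairs are edges of the graph at the end of the block,
whatever its earlier state. Fresh states are independent over pairs and blocks, each with
probability `p = (1 - exp (-rate * T)) * q`, where `q = 1 / n` at criticality (`measure_fresh`). So
the number of blocks needed is dominated by a geometric variable, and the expected time is at most
`T / Q`, where `Q` is the probability that the random graph with edge probability `p` has a
component of size at least `ε n` (`lintegral_componentTime_le`).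

To bound `Q` from below, take `k = ⌈ε n⌉` and count rooted tree components on `k` vertices. There
are at least `k ^ (k - 1)` rooted trees on each vertex set, and a configuration has at most `n`
rooted tree components, one per root. Hence `n * Q` is at least the expected number of them
(`le_card_mul_sum_hasComponentOfSize`).

With `p` close to `1 / n`, the factor `exp (k - k ^ 2 / (2 n))` from Stirling cancels against the
probability that no other edge touches the tree. Only a cubic cost `exp (-k ^ 3 / (2 n ^ 2))`
remains, together with polynomial factors and `c ^ n`, where `c = 1 - exp (-α T)`
(`le_componentProb`). The quadratic term `ε' ^ 2 / 16` is thus a free budget: half of it pays for `c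
^ n` with `T` independent of `n`, half for the polynomial factors and `n ^ (-1/2)`. -/

namespace DynamicER

/-! ### Counting rooted labelled trees -/

section RootedForests

variable {σ : Type*}

/-- `f` is the parent map of a rooted forest: `h` decreases towards the roots and `ρ v` is the root
of the tree of `v`. -/
def IsParentMap (f : σ → Option σ) : Prop :=
  ∃ (h : σ → ℕ) (ρ : σ → σ), (∀ v, f v = none → ρ v = v) ∧
    ∀ v w, f v = some w → h w < h v ∧ ρ w = ρ v

/-- Hanging a root below `v` creates a cycle only if it is the root of the tree containing `v`. -/
theorem IsParentMap.exists_root {f : σ → Option σ} (hf : IsParentMap f) (v : σ) :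
    ∃ s, ∀ r, f r = none → r ≠ s →
      open Classical in IsParentMap (Function.update f r (some v)) := by
  classical
  obtain ⟨h, ρ, hρ, hh⟩ := hf
  -- The whole tree of `r` is lifted above the height of `v` and relabelled with the root of `v`.
  refine ⟨ρ v, fun r hr hrs => ⟨fun u => h u + if ρ u = r then h v + 1 else 0,
    fun u => if ρ u = r then ρ v else ρ u, ?_, ?_⟩⟩
  · intro u hu
    by_cases hur : u = r
    · subst hur; simp at hu
    · rw [Function.update_of_ne hur] at hu
      simp [hρ u hu, hur]
  · intro u w hu
    by_cases hur : u = r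
    · subst hur
      simp only [Function.update_self, Option.some.injEq] at hu
      subst hu
      simp only [hρ u hr, if_true, Ne.symm hrs, if_false]
      exact ⟨by omega, trivial⟩
    · rw [Function.update_of_ne hur] at hu
      obtain ⟨h1, h2⟩ := hh u w hu
      simp only [h2]
      exact ⟨by omega, trivial⟩

variable [Fintype σ]

open Classical in
/-- Parent maps of rooted forests with exactly `i` vertices that are not roots. -/
noncomputable def rootedForests (σ : Type*) [Fintype σ] (i : ℕ) : Finset (σ → Option σ) :=
  Finset.univ.filter fun f => IsParentMap f ∧ (Finset.univ.filter fun v => f v ≠ none).card = i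

open Classical in
theorem update_mem_rootedForests {i : ℕ} {f : σ → Option σ} (hf : f ∈ rootedForests σ i) {r v : σ}
    (hr : f r = none) (hp : IsParentMap (Function.update f r (some v))) :
    Function.update f r (some v) ∈ rootedForests σ (i + 1) := by
  simp only [rootedForests, Finset.mem_filter, Finset.mem_univ, true_and] at hf ⊢
  refine ⟨hp, ?_⟩
  rw [← hf.2, ← Finset.card_insert_of_notMem (a := r) (by simp [hr])]
  congr 1
  ext u
  by_cases hur : u = r
  · subst hur; simp
  · simp [hur]

/-- Double counting in the style of Pitman: a forest with `i` non-roots has `card σ - i` trees. For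
each vertex `v`, all but one of their roots can be attached to `v`. Conversely a forest with `i + 1`
non-roots arises at most once for each non-root, by cutting its parent edge. -/
theorem card_rootedForests_succ (i : ℕ) :
    (rootedForests σ i).card * (Fintype.card σ * (Fintype.card σ - i - 1)) ≤
      (rootedForests σ (i + 1)).card * (i + 1) := by
  classical
  let R : (σ → Option σ) × σ → Finset σ := fun x =>
    Finset.univ.filter fun r => x.1 r = none ∧ IsParentMap (Function.update x.1 r (some x.2))
  have hsrc : (rootedForests σ i).card * (Fintype.card σ * (Fintype.card σ - i - 1)) ≤
      (((rootedForests σ i) ×ˢ (Finset.univ : Finset σ)).sigma R).card := by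
    rw [Finset.card_sigma, ← mul_assoc, ← Finset.card_univ, ← Finset.card_product]
    rw [← smul_eq_mul, Finset.card_univ]
    refine Finset.card_nsmul_le_sum _ _ _ fun x hx => ?_
    simp only [Finset.mem_product, rootedForests, Finset.mem_filter, Finset.mem_univ,
      true_and, and_true] at hx
    obtain ⟨s, hs⟩ := hx.1.exists_root x.2
    have h1 : ((Finset.univ.filter fun r => x.1 r = none).erase s) ⊆ R x := by
      intro r hr
      simp only [Finset.mem_erase, Finset.mem_filter, Finset.mem_univ, true_and] at hr
      simp only [R, Finset.mem_filter, Finset.mem_univ, true_and]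
      refine ⟨hr.2, ?_⟩
      convert hs r hr.2 hr.1
    have h2 := Finset.card_le_card h1
    have h3 := Finset.pred_card_le_card_erase (s := Finset.univ.filter fun r => x.1 r = none)
      (a := s)
    have h4 := Finset.card_filter_add_card_filter_not (s := (Finset.univ : Finset σ))
      (fun r => x.1 r = none)
    rw [Finset.card_univ] at h4
    simp only [ne_eq] at hx
    omega
  have htgt : (((rootedForests σ (i + 1))).sigma fun f =>
      Finset.univ.filter fun v => f v ≠ none).card = (rootedForests σ (i + 1)).card * (i + 1) := by
    rw [Finset.card_sigma, ← smul_eq_mul]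
    refine Finset.sum_const_nat fun f hf => ?_
    simp only [rootedForests, Finset.mem_filter, Finset.mem_univ, true_and] at hf
    convert hf.2
  rw [← htgt]
  -- Injective: `v` is the new parent of `r`, and the old map is recovered by making `r` a root
  -- again.
  refine hsrc.trans (Finset.card_le_card_of_injOn
    (fun x => ⟨Function.update x.1.1 x.2 (some x.1.2), x.2⟩) ?_ ?_)
  · rintro ⟨⟨f, v⟩, r⟩ hx
    simp only [R, Finset.coe_sigma, Set.mem_sigma_iff, Finset.mem_coe, Finset.mem_product,
      Finset.mem_univ, and_true, Finset.mem_filter, true_and] at hx ⊢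
    exact ⟨by convert update_mem_rootedForests hx.1 hx.2.1 (by convert hx.2.2), by simp⟩
  · rintro ⟨⟨f, v⟩, r⟩ hx ⟨⟨f', v'⟩, r'⟩ hx' heq
    simp only [R, Finset.coe_sigma, Set.mem_sigma_iff, Finset.mem_coe, Finset.mem_product,
      Finset.mem_univ, and_true, Finset.mem_filter, true_and] at hx hx'
    simp only [Sigma.mk.injEq, heq_eq_eq] at heq
    obtain ⟨h1, rfl⟩ := heq
    have hv : v = v' := by simpa using congrFun h1 r
    have hff : f = f' := by
      funext u
      by_cases hur : u = r
      · rw [hur, hx.2.1, hx'.2.1]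
      · simpa [hur] using congrFun h1 u
    rw [hv, hff]

theorem pow_mul_descFactorial_le (i : ℕ) :
    Fintype.card σ ^ i * (Fintype.card σ - 1).descFactorial i ≤
      (rootedForests σ i).card * i.factorial := by
  induction i with
  | zero =>
    have : (fun _ => none) ∈ rootedForests σ 0 := by
      simp only [rootedForests, Finset.mem_filter, Finset.mem_univ, true_and]
      exact ⟨⟨fun _ => 0, id, by simp, by simp⟩, by simp⟩
    simpa using Finset.card_pos.2 ⟨_, this⟩
  | succ i ih =>
    have h := card_rootedForests_succ (σ := σ) i
    calc _ = (Fintype.card σ ^ i * (Fintype.card σ - 1).descFactorial i) *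
          (Fintype.card σ * (Fintype.card σ - i - 1)) := by
          rw [Nat.descFactorial_succ, pow_succ,
            show Fintype.card σ - 1 - i = Fintype.card σ - i - 1 by omega]; ring
      _ ≤ ((rootedForests σ i).card * i.factorial) *
          (Fintype.card σ * (Fintype.card σ - i - 1)) := Nat.mul_le_mul_right _ ih
      _ = ((rootedForests σ i).card *
          (Fintype.card σ * (Fintype.card σ - i - 1))) * i.factorial := by ring
      _ ≤ ((rootedForests σ (i + 1)).card * (i + 1)) * i.factorial := Nat.mul_le_mul_right _ h
      _ = _ := by rw [Nat.factorial_succ]; ring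

/-- There are at least `k ^ (k - 1)` rooted labelled trees on `k` vertices. -/
theorem card_pow_le_card_rootedForests :
    Fintype.card σ ^ (Fintype.card σ - 1) ≤ (rootedForests σ (Fintype.card σ - 1)).card := by
  have h := pow_mul_descFactorial_le (σ := σ) (Fintype.card σ - 1)
  rw [Nat.descFactorial_self] at h
  exact Nat.le_of_mul_le_mul_right h (Nat.factorial_pos _)

end RootedForests

/-! ### Tree components of random graphs with independent edges -/

/-- The graph on `n` vertices whose edges are the pairs with state `true`. -/
def configGraph {n : ℕ} (z : VertexPair n → Bool) : SimpleGraph (Fin n) :=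
  SimpleGraph.fromEdgeSet {e | ∃ h : ¬ e.IsDiag, z ⟨e, h⟩ = true}

theorem configGraph_adj {n : ℕ} {z : VertexPair n → Bool} {a b : Fin n} :
    (configGraph z).Adj a b ↔ ∃ h : ¬ (s(a, b) : Sym2 (Fin n)).IsDiag, z ⟨s(a, b), h⟩ = true := by
  simp only [configGraph, SimpleGraph.fromEdgeSet_adj, Set.mem_ofPred_eq]
  refine ⟨fun h => h.1, fun h => ⟨h, fun hab => h.1 (by simp [hab])⟩⟩

/-- The law of a Bernoulli variable, as a weight on `Bool`. -/
def bernWeight (p : ℝ) (a : Bool) : ℝ := if a then p else 1 - p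

theorem bernWeight_nonneg {p : ℝ} (h0 : 0 ≤ p) (h1 : p ≤ 1) (a : Bool) : 0 ≤ bernWeight p a := by
  cases a <;> simp [bernWeight, h0, h1]

section TreeEvent

variable {n : ℕ}

/-- The vertex pair `e` joins a vertex of `S` to its parent. -/
def IsParentEdge (S : Finset (Fin n)) (f : S → Option S) (e : VertexPair n) : Prop :=
  ∃ v w : S, f v = some w ∧ e.1 = s(v.1, w.1)

/-- The vertex pair `e` has an endpoint in `S`. -/
def Touches (S : Finset (Fin n)) (e : VertexPair n) : Prop := ∃ v ∈ S, v ∈ e.1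

theorem IsParentEdge.touches {S : Finset (Fin n)} {f : S → Option S} {e : VertexPair n}
    (h : IsParentEdge S f e) : Touches S e := by
  obtain ⟨v, w, -, he⟩ := h
  exact ⟨v, v.2, by simp [he]⟩

open Classical in
/-- The configurations in which the edges touching `S` are exactly the edges from a vertex of `S`
to its parent. -/
noncomputable def treeEvent (S : Finset (Fin n)) (f : S → Option S) :
    Finset (VertexPair n → Bool) :=
  Finset.univ.filter fun z => ∀ e, Touches S e → (z e = true ↔ IsParentEdge S f e)

theorem mem_treeEvent {S : Finset (Fin n)} {f : S → Option S} {z : VertexPair n → Bool} :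
    z ∈ treeEvent S f ↔ ∀ e, Touches S e → (z e = true ↔ IsParentEdge S f e) := by
  simp [treeEvent]

open Classical in
theorem card_isParentEdge_le {S : Finset (Fin n)} {f : S → Option S} {i : ℕ}
    (hf : f ∈ rootedForests S i) :
    (Finset.univ.filter fun e : VertexPair n => IsParentEdge S f e).card ≤ i := by
  simp only [rootedForests, Finset.mem_filter, Finset.mem_univ, true_and] at hf
  rw [← hf.2, ← Finset.card_image_of_injective (Finset.univ.filter _)
    (Subtype.val_injective : Function.Injective (Subtype.val : VertexPair n → Sym2 (Fin n)))]
  refine le_trans (Finset.card_le_card (t := (Finset.univ.filter fun v => f v ≠ none).image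
    fun v => s(v.1, ((f v).getD v).1)) ?_) Finset.card_image_le
  intro e he
  simp only [Finset.mem_image, Finset.mem_filter, Finset.mem_univ, true_and] at he ⊢
  obtain ⟨e, ⟨v, w, hv, hvw⟩, rfl⟩ := he
  exact ⟨v, by simp [hv], by simp [hv, hvw]⟩

open Classical in
theorem card_touches_add_le (S : Finset (Fin n)) :
    (Finset.univ.filter fun e : VertexPair n => Touches S e).card + (n - S.card).choose 2 ≤
      n.choose 2 := by
  have h1 : Fintype.card (VertexPair n) = n.choose 2 := by
    simpa using Sym2.card_subtype_not_diag (α := Fin n)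
  have h2 : Fintype.card {e : Sym2 (Sᶜ : Finset (Fin n)) // ¬ e.IsDiag} =
      (n - S.card).choose 2 := by
    simpa using Sym2.card_subtype_not_diag (α := (Sᶜ : Finset (Fin n)))
  have h3 := Finset.card_filter_add_card_filter_not (s := (Finset.univ : Finset (VertexPair n)))
    (fun e => Touches S e)
  rw [Finset.card_univ, h1] at h3
  rw [← h3, ← h2, ← Finset.card_univ]
  refine Nat.add_le_add_left ?_ _
  have hinj : Function.Injective (Sym2.map (Subtype.val : (Sᶜ : Finset (Fin n)) → Fin n)) :=
    Sym2.map.injective Subtype.val_injective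
  have hdiag : ∀ e : Sym2 (Sᶜ : Finset (Fin n)), ¬ e.IsDiag →
      ¬ (Sym2.map (Subtype.val : (Sᶜ : Finset (Fin n)) → Fin n) e).IsDiag := by
    intro e
    induction e using Sym2.ind with
    | _ a b =>
      rw [Sym2.map_mk, Sym2.mk_isDiag_iff, Sym2.mk_isDiag_iff]
      exact fun h h' => h (Subtype.ext h')
  refine Finset.card_le_card_of_injOn (fun e => ⟨Sym2.map Subtype.val e.1, hdiag e.1 e.2⟩) ?_ ?_
  · rintro ⟨e, he⟩ -
    refine Finset.mem_coe.2 (Finset.mem_filter.2 ⟨Finset.mem_univ _, ?_⟩)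
    rintro ⟨v, hv, hve⟩
    rw [Sym2.mem_map] at hve
    obtain ⟨a, -, rfl⟩ := hve
    exact (Finset.mem_compl.1 a.2) hv
  · intro e _ e' _ h
    exact Subtype.ext (hinj (congrArg Subtype.val h))

-- Edges are independent, so the weight of the event factorizes over pairs. Counting `1 - p` for
-- parent edges as well only lowers the bound.
open Classical in
theorem le_sum_treeEvent {p : ℝ} (h0 : 0 ≤ p) (h1 : p ≤ 1) {S : Finset (Fin n)}
    {f : S → Option S} {i : ℕ} (hf : f ∈ rootedForests S i) :
    p ^ i * (1 - p) ^ (n.choose 2 - (n - S.card).choose 2) ≤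
      ∑ z ∈ treeEvent S f, ∏ e, bernWeight p (z e) := by
  have hev : treeEvent S f = Fintype.piFinset fun e : VertexPair n =>
      Finset.univ.filter fun a : Bool => Touches S e → (a = true ↔ IsParentEdge S f e) := by
    ext z
    simp [mem_treeEvent, Fintype.mem_piFinset]
  rw [hev, ← Finset.prod_univ_sum (fun e => Finset.univ.filter fun a : Bool =>
    Touches S e → (a = true ↔ IsParentEdge S f e)) (fun _ a => bernWeight p a)]
  have hq : 0 ≤ 1 - p := by linarith
  calc p ^ i * (1 - p) ^ (n.choose 2 - (n - S.card).choose 2)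
      ≤ p ^ (Finset.univ.filter fun e : VertexPair n => IsParentEdge S f e).card *
        (1 - p) ^ (Finset.univ.filter fun e : VertexPair n => Touches S e).card := by
        refine mul_le_mul (pow_le_pow_of_le_one h0 h1 (card_isParentEdge_le hf))
          (pow_le_pow_of_le_one hq (by linarith) ?_) (by positivity) (by positivity)
        have := card_touches_add_le S
        omega
    _ = ∏ e : VertexPair n, ((if IsParentEdge S f e then p else 1) *
        (if Touches S e then 1 - p else 1)) := by
        rw [Finset.prod_mul_distrib]
        simp [Finset.prod_ite]
    _ ≤ _ := by
        refine Finset.prod_le_prod (fun e _ => by positivity) fun e _ => ?_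
        by_cases ht : Touches S e
        · by_cases hp : IsParentEdge S f e
          · simp only [ht, hp, if_true, iff_true, true_imp_iff]
            simp only [Finset.filter_eq', Finset.mem_univ, if_true, Finset.sum_singleton,
              bernWeight]
            nlinarith
          · simp only [ht, hp, if_true, if_false, iff_false, true_imp_iff, Bool.not_eq_true]
            simp [Finset.filter_eq', bernWeight]
        · have hp : ¬ IsParentEdge S f e := fun h => ht h.touches
          simp [ht, hp, bernWeight]

/-! ### Tree components and their uniqueness given the root -/

theorem exists_root_of_mem {S : Finset (Fin n)} {f : S → Option S} (hS : 0 < S.card)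
    (hf : f ∈ rootedForests S (S.card - 1)) : ∃ r : S, ∀ v, f v = none ↔ v = r := by
  classical
  simp only [rootedForests, Finset.mem_filter, Finset.mem_univ, true_and] at hf
  have h3 := Finset.card_filter_add_card_filter_not (s := (Finset.univ : Finset S))
    (fun v => f v = none)
  rw [Finset.card_univ, Fintype.card_coe] at h3
  have h4 : (Finset.univ.filter fun v : S => f v = none).card = 1 := by
    have := hf.2
    simp only [ne_eq] at this
    have h5 : (Finset.univ.filter fun v : S => ¬ f v = none).card = S.card - 1 := by
      convert this
    omega
  obtain ⟨r, hr⟩ := Finset.card_eq_one.1 h4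
  refine ⟨r, fun v => ?_⟩
  have := Finset.ext_iff.1 hr v
  simpa using this

theorem isParentMap_of_mem {S : Finset (Fin n)} {f : S → Option S} {i : ℕ}
    (hf : f ∈ rootedForests S i) : ∃ h : S → ℕ, ∀ v w, f v = some w → h w < h v := by
  simp only [rootedForests, Finset.mem_filter, Finset.mem_univ, true_and] at hf
  obtain ⟨⟨h, ρ, -, hh⟩, -⟩ := hf
  exact ⟨h, fun v w hvw => (hh v w hvw).1⟩

theorem parent_ne {S : Finset (Fin n)} {f : S → Option S} {i : ℕ}
    (hf : f ∈ rootedForests S i) {v w : S} (h : f v = some w) :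
    ¬ (s(v.1, w.1) : Sym2 (Fin n)).IsDiag := by
  obtain ⟨r, hr⟩ := isParentMap_of_mem hf
  intro hd
  have hvw : v = w := Subtype.ext (by simpa using hd)
  have := hr v w h
  simp [hvw] at this

theorem apply_parent_eq_true {S : Finset (Fin n)} {f : S → Option S} {i : ℕ}
    (hf : f ∈ rootedForests S i) {z : VertexPair n → Bool} (hz : z ∈ treeEvent S f) {v w : S}
    (h : f v = some w) : z ⟨s(v.1, w.1), parent_ne hf h⟩ = true := by
  have hp : IsParentEdge S f ⟨s(v.1, w.1), parent_ne hf h⟩ := ⟨v, w, h, rfl⟩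
  exact (mem_treeEvent.1 hz _ hp.touches).2 hp

theorem reachable_root {S : Finset (Fin n)} {f : S → Option S} {i : ℕ}
    (hf : f ∈ rootedForests S i) {r : S} (hr : ∀ v, f v = none ↔ v = r)
    {z : VertexPair n → Bool} (hz : z ∈ treeEvent S f) (v : S) :
    (configGraph z).Reachable v.1 r.1 := by
  obtain ⟨h, hh⟩ := isParentMap_of_mem hf
  induction hm : h v using Nat.strong_induction_on generalizing v with
  | _ m ih =>
    cases hv : f v with
    | none => rw [(hr v).1 hv]
    | some w =>
      have hadj : (configGraph z).Adj v.1 w.1 :=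
        configGraph_adj.2 ⟨parent_ne hf hv, apply_parent_eq_true hf hz hv⟩
      exact hadj.reachable.trans (ih (h w) (hm ▸ hh v w hv) w rfl)

theorem hasComponentOfSize_of_mem_treeEvent {S : Finset (Fin n)} {f : S → Option S}
    (hS : 0 < S.card) (hf : f ∈ rootedForests S (S.card - 1)) {z : VertexPair n → Bool}
    (hz : z ∈ treeEvent S f) {x : ℝ} (hx : x ≤ S.card) : HasComponentOfSize (configGraph z) x := by
  obtain ⟨r, hr⟩ := exists_root_of_mem hS hf
  refine ⟨(configGraph z).connectedComponentMk r.1, hx.trans ?_⟩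
  rw [← Set.ncard_coe_finset S]
  refine Nat.cast_le.2 (Set.ncard_le_ncard (fun v hv => ?_) (Set.toFinite _))
  rw [SimpleGraph.ConnectedComponent.mem_supp_iff, SimpleGraph.ConnectedComponent.eq]
  exact reachable_root hf hr hz ⟨v, hv⟩

/-- Going up from the root: if the parent of `v` lies in `S'`, the present edge to `v` touches `S'`,
hence is a parent edge of `f'` and has both ends in `S'`. -/
theorem subset_of_root_mem {S S' : Finset (Fin n)} {f : S → Option S} {f' : S' → Option S'}
    {i : ℕ} (hf : f ∈ rootedForests S i) {r : S} (hr : ∀ v, f v = none ↔ v = r) (hrS : r.1 ∈ S')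
    {z : VertexPair n → Bool} (hz : z ∈ treeEvent S f) (hz' : z ∈ treeEvent S' f') : S ⊆ S' := by
  obtain ⟨h, hh⟩ := isParentMap_of_mem hf
  suffices H : ∀ v : S, v.1 ∈ S' from fun v hv => H ⟨v, hv⟩
  intro v
  induction hm : h v using Nat.strong_induction_on generalizing v with
  | _ m ih =>
    cases hv : f v with
    | none => rw [(hr v).1 hv]; exact hrS
    | some w =>
      have hw := ih (h w) (hm ▸ hh v w hv) w rfl
      have he := apply_parent_eq_true hf hz hv
      obtain ⟨a, b, -, hab⟩ := (mem_treeEvent.1 hz' ⟨s(v.1, w.1), parent_ne hf hv⟩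
        ⟨w.1, hw, by simp⟩).1 he
      simp only [Sym2.eq_iff] at hab
      rcases hab with ⟨h1, -⟩ | ⟨h1, -⟩ <;> rw [h1] <;> exact Subtype.coe_prop _

theorem parentMap_unique {S : Finset (Fin n)} {f g : S → Option S} {i : ℕ}
    (hf : f ∈ rootedForests S i) {r : S}
    (hr : ∀ v, f v = none ↔ v = r) (hr' : ∀ v, g v = none ↔ v = r)
    {z : VertexPair n → Bool} (hz : z ∈ treeEvent S f) (hz' : z ∈ treeEvent S g) : f = g := by
  obtain ⟨h, hh⟩ := isParentMap_of_mem hf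
  funext v
  induction hm : h v using Nat.strong_induction_on generalizing v with
  | _ m ih =>
    cases hv : f v with
    | none => exact ((hr' v).2 ((hr v).1 hv)).symm
    | some w =>
      have hw := ih (h w) (hm ▸ hh v w hv) w rfl
      have he := apply_parent_eq_true hf hz hv
      obtain ⟨a, b, hab, hs⟩ := (mem_treeEvent.1 hz' ⟨s(v.1, w.1), parent_ne hf hv⟩
        ⟨w.1, w.2, by simp⟩).1 he
      simp only [Sym2.eq_iff] at hs
      rcases hs with ⟨h1, h2⟩ | ⟨h1, h2⟩
      · rw [← Subtype.ext_iff] at h1 h2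
        rw [h1, h2, hab]
      -- Reversed orientation: here `g` sends `w` to `v`, and by induction so does `f`, so the
      -- heights of `v` and `w` would each be below the other.
      · rw [← Subtype.ext_iff] at h1 h2
        subst h1 h2
        rw [hab] at hw
        have l1 := hh _ _ hw
        have l2 := hh _ _ hv
        omega

open Classical in
/-- Each configuration contains at most one rooted tree component per root. -/
theorem card_treeEvent_le {k : ℕ} (hk : 0 < k) (z : VertexPair n → Bool) :
    (((Finset.powersetCard k (Finset.univ : Finset (Fin n))).sigma
      fun S => rootedForests S (k - 1)).filter fun x => z ∈ treeEvent x.1 x.2).card ≤ n := by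
  have hroot : ∀ x : (Σ S : Finset (Fin n), (S → Option S)),
      x ∈ (Finset.powersetCard k (Finset.univ : Finset (Fin n))).sigma
        (fun S => rootedForests S (k - 1)) → ∃ r : Fin n, ∃ h : r ∈ x.1,
          ∀ v, x.2 v = none ↔ v = ⟨r, h⟩ := by
    rintro ⟨S, f⟩ hx
    simp only [Finset.mem_sigma, Finset.mem_powersetCard, Finset.subset_univ, true_and] at hx
    obtain ⟨rfl, hf⟩ := hx
    obtain ⟨r, hr⟩ := exists_root_of_mem hk hf
    exact ⟨r.1, r.2, hr⟩
  rcases Nat.eq_zero_or_pos n with rfl | hn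
  · refine (Finset.card_eq_zero.2 (Finset.filter_eq_empty_iff.2 fun x hx _ => ?_)).le
    exact (hroot x hx).choose.elim0
  have : Nonempty (Fin n) := ⟨⟨0, hn⟩⟩
  choose! root hroot using hroot
  conv_rhs => rw [← Fintype.card_fin n, ← Finset.card_univ]
  refine Finset.card_le_card_of_injOn root (fun _ _ => Finset.mem_coe.2 (Finset.mem_univ _)) ?_
  rintro ⟨S, f⟩ hx ⟨S', f'⟩ hx' heq
  rw [Finset.mem_coe, Finset.mem_filter] at hx hx'
  obtain ⟨hm, hr⟩ := hroot _ hx.1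
  obtain ⟨hm', hr'⟩ := hroot _ hx'.1
  simp only [Finset.mem_sigma, Finset.mem_powersetCard, Finset.subset_univ, true_and] at hx hx'
  rw [← heq] at hm'
  simp only [← heq] at hr'
  have hSS : S = S' := (subset_of_root_mem hx.1.2 hr hm' hx.2 hx'.2).antisymm
    (subset_of_root_mem hx'.1.2 hr' hm hx'.2 hx.2)
  subst hSS
  rw [parentMap_unique hx.1.2 hr hr' hx.2 hx'.2]

open Classical in
/-- A lower bound for the probability that a random graph has a component of size at least `x`. -/
theorem le_card_mul_sum_hasComponentOfSize {p : ℝ} (h0 : 0 ≤ p) (h1 : p ≤ 1) {k : ℕ} (hk : 0 < k)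
    {x : ℝ} (hx : x ≤ k) :
    n.choose k * (k : ℝ) ^ (k - 1) *
        (p ^ (k - 1) * (1 - p) ^ (n.choose 2 - (n - k).choose 2)) ≤
      n * ∑ z : VertexPair n → Bool with HasComponentOfSize (configGraph z) x,
        ∏ e, bernWeight p (z e) := by
  set P := (Finset.powersetCard k (Finset.univ : Finset (Fin n))).sigma
      fun S => rootedForests S (k - 1) with hP
  set W : (VertexPair n → Bool) → ℝ := fun z => ∏ e, bernWeight p (z e) with hW
  set c := p ^ (k - 1) * (1 - p) ^ (n.choose 2 - (n - k).choose 2) with hc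
  have hc0 : 0 ≤ c := mul_nonneg (pow_nonneg h0 _) (pow_nonneg (by linarith) _)
  have hW0 : ∀ z, 0 ≤ W z := fun z => Finset.prod_nonneg fun e _ => bernWeight_nonneg h0 h1 _
  have hcard : n.choose k * k ^ (k - 1) ≤ P.card := by
    rw [hP, Finset.card_sigma, ← smul_eq_mul]
    have : (Finset.powersetCard k (Finset.univ : Finset (Fin n))).card = n.choose k := by simp
    rw [← this]
    refine Finset.card_nsmul_le_sum _ _ _ fun S hS => ?_
    have hS' : S.card = k := (Finset.mem_powersetCard.1 hS).2
    have := card_pow_le_card_rootedForests (σ := S)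
    rwa [Fintype.card_coe, hS'] at this
  -- First moment bound: the expected number of rooted tree components is computed by exchanging the
  -- sums over trees and configurations.
  calc n.choose k * (k : ℝ) ^ (k - 1) * c ≤ P.card * c := by
        refine mul_le_mul_of_nonneg_right ?_ hc0
        exact_mod_cast hcard
    _ ≤ ∑ y ∈ P, ∑ z ∈ treeEvent y.1 y.2, W z := by
        rw [← nsmul_eq_mul]
        refine Finset.card_nsmul_le_sum _ _ _ fun y hy => ?_
        obtain ⟨hy1, hy2⟩ := Finset.mem_sigma.1 hy
        have hS : y.1.card = k := (Finset.mem_powersetCard.1 hy1).2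
        have := le_sum_treeEvent h0 h1 hy2
        rwa [hS] at this
    _ = ∑ y ∈ P, ∑ z with HasComponentOfSize (configGraph z) x,
          if z ∈ treeEvent y.1 y.2 then W z else 0 := by
        refine Finset.sum_congr rfl fun y hy => ?_
        rw [← Finset.sum_filter]
        refine Finset.sum_congr ?_ fun _ _ => rfl
        ext z
        simp only [Finset.mem_filter, Finset.mem_univ, true_and]
        refine ⟨fun hz => ⟨?_, hz⟩, fun hz => hz.2⟩
        obtain ⟨hy1, hy2⟩ := Finset.mem_sigma.1 hy
        have hS : y.1.card = k := (Finset.mem_powersetCard.1 hy1).2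
        rw [← hS] at hy2 hx hk
        exact hasComponentOfSize_of_mem_treeEvent hk hy2 hz hx
    _ = ∑ z with HasComponentOfSize (configGraph z) x,
          ((P.filter fun y => z ∈ treeEvent y.1 y.2).card : ℝ) * W z := by
        rw [Finset.sum_comm]
        refine Finset.sum_congr rfl fun z _ => ?_
        rw [← Finset.sum_filter, Finset.sum_const, nsmul_eq_mul]
    _ ≤ ∑ z with HasComponentOfSize (configGraph z) x, (n : ℝ) * W z := by
        refine Finset.sum_le_sum fun z _ => mul_le_mul_of_nonneg_right ?_ (hW0 z)
        exact_mod_cast card_treeEvent_le hk z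
    _ = _ := by rw [Finset.mul_sum]

end TreeEvent

/-! ### Fresh edges in successive time blocks -/

section Fresh

variable {Ω : Type*} [MeasurableSpace Ω] {μ : Measure Ω}

theorem measurable_apply_nat {α : Type*} [MeasurableSpace α] {g : ℕ → α → Bool} {f : α → ℕ}
    (hg : ∀ k, Measurable (g k)) (hf : Measurable f) : Measurable fun a => g (f a) a :=
  (measurable_from_prod_countable_right (f := fun x : ℕ × α => g x.1 x.2) hg).comp
    (hf.prodMk measurable_id)

/-- If the counts at the ends of a time block are `a` and `b`, and `c k` is the result of update
`k + 1`, then this says whether there is an update in the block, the last of which is positive. -/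
def fresh (a b : ℕ) (c : ℕ → Bool) : Bool := decide (a < b) && c (b - 1)

/-- The probability of the value `y` for `fresh` if there are `d` updates in the block. -/
noncomputable def freshProb (q : ℝ) (y : Bool) (d : ℕ) : ℝ≥0∞ :=
  if d = 0 then (if y then 0 else 1) else ENNReal.ofReal (bernWeight q y)

theorem measurable_fresh {a b : Ω → ℕ} {c : ℕ → Ω → Bool} (ha : Measurable a) (hb : Measurable b)
    (hc : ∀ k, Measurable (c k)) : Measurable fun ω => fresh (a ω) (b ω) fun k => c k ω := by
  have h1 : Measurable fun ω => c (b ω - 1) ω :=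
    measurable_apply_nat hc ((measurable_of_countable fun m : ℕ => m - 1).comp hb)
  exact (measurable_of_countable fun x : (ℕ × ℕ) × Bool => decide (x.1.1 < x.1.2) && x.2).comp
    ((ha.prodMk hb).prodMk h1)

variable {B : ℕ → Ω → Bool} {q : ℝ}

theorem lintegral_freshProb {D : Ω → ℕ} {s : ℝ≥0} (hD : HasLaw D (poissonMeasure s) μ)
    (h0 : 0 ≤ q) (h1 : q ≤ 1) (y : Bool) :
    ∫⁻ ω, freshProb q y (D ω) ∂μ =
      ENNReal.ofReal (bernWeight ((1 - Real.exp (-s)) * q) y) := by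
  have hw := bernWeight_nonneg h0 h1 y
  have he0 := Real.exp_pos (-(s : ℝ))
  have he1 : Real.exp (-(s : ℝ)) ≤ 1 := by simp
  have hlaw : ∫⁻ ω, freshProb q y (D ω) ∂μ = ∫⁻ d, freshProb q y d ∂(poissonMeasure s) := by
    rw [← hD.map_eq, lintegral_map' (measurable_of_countable _).aemeasurable hD.aemeasurable]
  have hs : poissonMeasure s {0} = ENNReal.ofReal (Real.exp (-s)) := by
    rw [poissonMeasure_singleton]; simp
  have hc : poissonMeasure s {0}ᶜ = ENNReal.ofReal (1 - Real.exp (-s)) := by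
    rw [prob_compl_eq_one_sub (measurableSet_singleton 0), hs,
      ENNReal.ofReal_sub _ he0.le, ENNReal.ofReal_one]
  rw [hlaw, ← lintegral_add_compl _ (measurableSet_singleton 0)]
  rw [setLIntegral_congr_fun (g := fun _ => freshProb q y 0) (measurableSet_singleton 0)
      (fun d hd => by rw [Set.mem_singleton_iff.1 hd]),
    setLIntegral_congr_fun (g := fun _ => ENNReal.ofReal (bernWeight q y))
      (measurableSet_singleton 0).compl
      (fun d hd => by
        have : d ≠ 0 := by simpa using hd
        simp [freshProb, this])]
  rw [setLIntegral_const, setLIntegral_const, hs, hc, ← ENNReal.ofReal_mul hw]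
  cases y with
  | true => simp [freshProb, bernWeight, mul_comm]
  | false =>
    simp only [freshProb, bernWeight, if_true, Bool.false_eq_true, if_false, one_mul]
    rw [← ENNReal.ofReal_add he0.le (mul_nonneg (by linarith) (by linarith))]
    congr 1
    ring

variable [IsProbabilityMeasure μ]

theorem measure_eq_bernWeight {C : Ω → Bool} (hC : Measurable C) (h0 : 0 ≤ q)
    (hq : μ {ω | C ω = true} = ENNReal.ofReal q) (y : Bool) :
    μ (C ⁻¹' {y}) = ENNReal.ofReal (bernWeight q y) := by
  have hset : {ω | C ω = true} = C ⁻¹' {true} := by ext ω; simp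
  rw [hset] at hq
  cases y with
  | true => simpa [bernWeight] using hq
  | false =>
    have : C ⁻¹' {false} = (C ⁻¹' {true})ᶜ := by ext ω; simp
    rw [this, prob_compl_eq_one_sub (hC (measurableSet_singleton true)), hq]
    simp [bernWeight, ENNReal.ofReal_sub _ h0]

/-- The case of deterministic counts: nonempty blocks have distinct last updates, whose results are
independent, and empty blocks are never fresh. -/
theorem measure_fresh_of_monotone (hB : ∀ k, Measurable (B k)) (hi : iIndepFun B μ) (h0 : 0 ≤ q)
    (hq : ∀ k, μ {ω | B k ω = true} = ENNReal.ofReal q) {m : ℕ → ℕ} (hm : Monotone m) (K : ℕ)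
    (y : Fin K → Bool) :
    μ {ω | ∀ j : Fin K, fresh (m j) (m (j + 1)) (fun k => B k ω) = y j} =
      ∏ j : Fin K, freshProb q (y j) (m (j + 1) - m j) := by
  classical
  by_cases hy : ∀ j : Fin K, ¬ m j < m (j + 1) → y j = false
  · have hinj : Function.Injective
        fun j : {j : Fin K // m j < m (j + 1)} => m (j.1 + 1) - 1 := by
      rintro ⟨i, hmi⟩ ⟨j, hmj⟩ hij
      simp only at hij
      rcases lt_trichotomy i j with h | h | h
      · have := hm (show (i : ℕ) + 1 ≤ j from h)
        omega
      · exact Subtype.ext h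
      · have := hm (show (j : ℕ) + 1 ≤ i from h)
        omega
    have hind := (hi.precomp hinj).measure_inter_preimage_eq_mul Finset.univ
      (sets := fun j => {y j.1}) (fun j _ => measurableSet_singleton _)
    have hev : {ω | ∀ j : Fin K, fresh (m j) (m (j + 1)) (fun k => B k ω) = y j} =
        ⋂ j ∈ (Finset.univ : Finset {j : Fin K // m j < m (j + 1)}),
          B (m (j.1 + 1) - 1) ⁻¹' {y j.1} := by
      ext ω
      simp only [Finset.mem_univ, Set.iInter_true, Set.mem_iInter, Set.mem_preimage,
        Set.mem_singleton_iff]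
      refine ⟨fun h j => ?_, fun h j => ?_⟩
      · simpa [fresh, j.2] using h j.1
      · by_cases hj : m j < m (j + 1)
        · simpa [fresh, hj] using h ⟨j, hj⟩
        · simp [fresh, hj, hy j hj]
    rw [hev]
    refine hind.trans ?_
    rw [Finset.prod_congr rfl fun j _ => measure_eq_bernWeight (hB _) h0 (hq _) (y j.1)]
    rw [← Fintype.prod_subtype_mul_prod_subtype (fun j : Fin K => m j < m (j + 1))]
    have h1 : ∏ j : {j : Fin K // ¬ m j < m (j + 1)},
        freshProb q (y j.1) (m (j.1 + 1) - m j.1) = 1 := by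
      refine Finset.prod_eq_one fun j _ => ?_
      have h2 : m (j.1 + 1) - m j.1 = 0 := by have := j.2; omega
      simp [freshProb, h2, hy j.1 j.2]
    rw [h1, mul_one]
    refine Finset.prod_congr rfl fun j _ => ?_
    have h2 : m (j.1 + 1) - m j.1 ≠ 0 := by have := j.2; omega
    simp [freshProb, h2]
  -- An empty block is required to be fresh, so both sides vanish.
  · push Not at hy
    obtain ⟨j, hj, hyj⟩ := hy
    have hyj : y j = true := by simpa using hyj
    rw [Finset.prod_eq_zero (Finset.mem_univ j)]
    · refine measure_mono_null (t := ∅) (fun ω hω => ?_) measure_empty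
      have := hω j
      simp [fresh, hyj, hj.not_gt] at this
    · have h2 : m (j + 1) - m j = 0 := by omega
      simp [freshProb, h2, hyj]

/-- The fresh states of a vertex pair in successive time blocks of length `T` are independent
Bernoulli variables. -/
theorem measure_fresh {N : ℝ≥0 → Ω → ℕ} {rate : ℝ≥0} (hN : IsPoissonProcess rate N μ)
    (hB : ∀ k, Measurable (B k)) (hi : iIndepFun B μ) (h0 : 0 ≤ q) (h1 : q ≤ 1)
    (hq : ∀ k, μ {ω | B k ω = true} = ENNReal.ofReal q)
    (hNB : IndepFun (fun ω (t : ℝ≥0) => N t ω) (fun ω (k : ℕ) => B k ω) μ) (T : ℝ≥0) (K : ℕ)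
    (y : Fin K → Bool) :
    μ {ω | ∀ j : Fin K,
        fresh (N ((j : ℕ) * T) ω) (N (((j : ℕ) + 1 : ℕ) * T) ω) (fun k => B k ω) = y j} =
      ∏ j : Fin K, ENNReal.ofReal (bernWeight ((1 - Real.exp (-(rate * T))) * q) (y j)) := by
  set t : ℕ → ℝ≥0 := fun j => (j : ℝ≥0) * T with ht
  have htm : Monotone t := fun i j hij => by
    simp only [ht]; gcongr
  set X : Ω → ℕ → ℕ := fun ω j => N (t j) ω with hX
  set Z : Ω → ℕ → Bool := fun ω k => B k ω with hZ
  have hXm : Measurable X := measurable_pi_lambda _ fun j => hN.measurable _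
  have hZm : Measurable Z := measurable_pi_lambda _ hB
  have hXZ : IndepFun X Z μ := hNB.comp (φ := fun (p : ℝ≥0 → ℕ) (j : ℕ) => p (t j)) (ψ := id)
    (measurable_pi_lambda _ fun j => measurable_pi_apply _) measurable_id
  let A : Set ((ℕ → ℕ) × (ℕ → Bool)) :=
    {x | ∀ j : Fin K, fresh (x.1 j) (x.1 (j + 1)) x.2 = y j}
  have hA : MeasurableSet A := by
    have : A = ⋂ j : Fin K, (fun x : (ℕ → ℕ) × (ℕ → Bool) =>
        fresh (x.1 j) (x.1 (j + 1)) x.2) ⁻¹' {y j} := by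
      ext x; simp [A]
    rw [this]
    refine MeasurableSet.iInter fun j => ?_
    refine measurable_fresh (a := fun x : (ℕ → ℕ) × (ℕ → Bool) => x.1 j)
      (b := fun x => x.1 (j + 1)) (c := fun k x => x.2 k) ?_ ?_ ?_ (measurableSet_singleton _)
    · exact (measurable_pi_apply _).comp measurable_fst
    · exact (measurable_pi_apply _).comp measurable_fst
    · exact fun k => (measurable_pi_apply _).comp measurable_snd
  -- Conditionally on the counts, which are independent of the update results, the deterministic
  -- case applies. The independent increments then split the remaining expectation.
  have hslice : ∀ᵐ ω ∂μ, (μ.map Z) (Prod.mk (X ω) ⁻¹' A) =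
      ∏ j : Fin K, freshProb q (y j) (X ω (j + 1) - X ω j) := by
    filter_upwards [hN.monotone] with ω hω
    rw [Measure.map_apply hZm (measurable_prodMk_left hA)]
    exact measure_fresh_of_monotone hB hi h0 hq (hω.comp htm) K y
  have hincr : iIndepFun (fun (j : Fin K) ω => X ω (j + 1) - X ω j) μ :=
    (hN.indep_increments.nat htm).precomp (g := fun j : Fin K => (j : ℕ)) Fin.val_injective
  calc _ = (μ.map fun ω => (X ω, Z ω)) A := by
        rw [Measure.map_apply (hXm.prodMk hZm) hA]
        rfl
    _ = ∫⁻ ω, (μ.map Z) (Prod.mk (X ω) ⁻¹' A) ∂μ := by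
        have : IsProbabilityMeasure (μ.map Z) := Measure.isProbabilityMeasure_map hZm.aemeasurable
        rw [(indepFun_iff_map_prod_eq_prod_map_map hXm.aemeasurable hZm.aemeasurable).1 hXZ,
          Measure.prod_apply hA, lintegral_map (measurable_measure_prodMk_left hA) hXm]
    _ = ∫⁻ ω, ∏ j : Fin K, freshProb q (y j) (X ω (j + 1) - X ω j) ∂μ := lintegral_congr_ae hslice
    _ = ∏ j : Fin K, ∫⁻ ω, freshProb q (y j) (X ω (j + 1) - X ω j) ∂μ := by
        refine lintegral_prod_eq_prod_lintegral_of_indepFun Finset.univ _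
          (hincr.comp (fun j d => freshProb q (y j) d) fun j => measurable_of_countable _)
          fun j => ?_
        exact (measurable_of_countable (freshProb q (y j))).comp
          ((measurable_of_countable fun x : ℕ × ℕ => x.1 - x.2).comp
            ((hN.measurable _).prodMk (hN.measurable _)))
    _ = _ := by
        refine Finset.prod_congr rfl fun j _ => ?_
        have hlaw := hN.increment_law (t j) (t (j + 1)) (htm (Nat.le_succ _))
        have hd : t (j + 1) - t j = T := by
          simp only [ht, Nat.cast_add, Nat.cast_one, add_mul, one_mul]
          exact add_tsub_cancel_left _ _
        rw [hd] at hlaw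
        rw [lintegral_freshProb hlaw h0 h1 (y j)]
        simp

end Fresh

/-! ### The expected time until a large component appears -/

theorem HasComponentOfSize.mono {V : Type*} [Finite V] {H H' : SimpleGraph V} (h : H ≤ H') {x : ℝ}
    (hx : HasComponentOfSize H x) : HasComponentOfSize H' x := by
  obtain ⟨C, hC⟩ := hx
  refine ⟨C.map (SimpleGraph.Hom.ofLE h), hC.trans (Nat.cast_le.2 ?_)⟩
  refine Set.ncard_le_ncard (fun v hv => ?_) (Set.toFinite _)
  rw [SimpleGraph.ConnectedComponent.mem_supp_iff] at hv ⊢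
  rw [← hv]
  rfl

open Classical in
/-- The probability that the random graph on `n` vertices with edge probability `p` has a component
of size at least `x`. -/
noncomputable def componentProb (n : ℕ) (p x : ℝ) : ℝ :=
  ∑ z : VertexPair n → Bool with HasComponentOfSize (configGraph z) x, ∏ e, bernWeight p (z e)

open Classical in
theorem sum_not_hasComponentOfSize (n : ℕ) (p x : ℝ) :
    ∑ z : VertexPair n → Bool with ¬ HasComponentOfSize (configGraph z) x,
      ∏ e, bernWeight p (z e) = 1 - componentProb n p x := by
  have h := Finset.sum_filter_add_sum_filter_not (Finset.univ : Finset (VertexPair n → Bool))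
    (fun z => HasComponentOfSize (configGraph z) x) (fun z => ∏ e, bernWeight p (z e))
  have h1 : ∑ z : VertexPair n → Bool, ∏ e, bernWeight p (z e) = 1 := by
    rw [← Fintype.prod_sum (fun (_ : VertexPair n) a => bernWeight p a)]
    simp [bernWeight]
  rw [h1] at h
  rw [← h, componentProb]
  ring

theorem componentTime_le {Ω V : Type*} {G : ℝ≥0 → Ω → SimpleGraph V} {x : ℝ} {ω : Ω} {t : ℝ≥0}
    (h : HasComponentOfSize (G t ω) x) : componentTime G x ω ≤ t :=
  iInf₂_le t h

section Blocks

variable {Ω : Type*} [MeasurableSpace Ω] {μ : Measure Ω} {n : ℕ}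

open Classical in
/-- The failure probability of the first `K` blocks, if the states `Y e j` of the vertex pairs in
the blocks are independent Bernoulli variables. -/
theorem measure_forall_not_hasComponentOfSize_le {Y : VertexPair n → ℕ → Ω → Bool} {p x : ℝ}
    (h0 : 0 ≤ p) (h1 : p ≤ 1) (K : ℕ)
    (hY : ∀ y : Fin K → VertexPair n → Bool, μ {ω | ∀ e, ∀ j : Fin K, Y e j ω = y j e} =
      ∏ e, ∏ j, ENNReal.ofReal (bernWeight p (y j e))) :
    μ {ω | ∀ j < K, ¬ HasComponentOfSize (configGraph fun e => Y e j ω) x} ≤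
      ENNReal.ofReal (1 - componentProb n p x) ^ K := by
  set bad : Finset (VertexPair n → Bool) :=
    Finset.univ.filter fun z => ¬ HasComponentOfSize (configGraph z) x with hbad
  have hw := bernWeight_nonneg h0 h1
  calc _ ≤ μ (⋃ y ∈ Fintype.piFinset fun _ : Fin K => bad,
          {ω | ∀ e, ∀ j : Fin K, Y e j ω = y j e}) := by
        refine measure_mono fun ω hω => ?_
        simp only [Set.mem_iUnion]
        refine ⟨fun j e => Y e j ω, ?_, fun e j => rfl⟩
        rw [Fintype.mem_piFinset]
        intro j
        rw [hbad, Finset.mem_filter]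
        exact ⟨Finset.mem_univ _, hω j j.2⟩
    _ ≤ ∑ y ∈ Fintype.piFinset fun _ : Fin K => bad,
          μ {ω | ∀ e, ∀ j : Fin K, Y e j ω = y j e} := measure_biUnion_finset_le _ _
    _ = ∑ y ∈ Fintype.piFinset fun _ : Fin K => bad,
          ∏ j, ∏ e, ENNReal.ofReal (bernWeight p (y j e)) :=
        Finset.sum_congr rfl fun y _ => by rw [hY, Finset.prod_comm]
    _ = ∏ _j : Fin K, ∑ z ∈ bad, ∏ e, ENNReal.ofReal (bernWeight p (z e)) :=
        (Finset.prod_univ_sum (fun _ : Fin K => bad)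
          (fun _ z => ∏ e, ENNReal.ofReal (bernWeight p (z e)))).symm
    _ = _ := by
        rw [Finset.prod_const, Finset.card_univ, Fintype.card_fin]
        congr 1
        rw [← sum_not_hasComponentOfSize,
          ENNReal.ofReal_sum_of_nonneg fun z _ => Finset.prod_nonneg fun e _ => hw _]
        exact Finset.sum_congr rfl fun z _ =>
          (ENNReal.ofReal_prod_of_nonneg fun e _ => hw _).symm

/-- The expected time until a large component appears is at most the length of a block divided by
the probability that such a component is created within a block. -/
theorem lintegral_componentTime_le [IsProbabilityMeasure μ] {α β : ℝ} {G₀ : SimpleGraph (Fin n)}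
    {G : ℝ≥0 → Ω → SimpleGraph (Fin n)} (hG : IsDynamicERGraph α β G₀ G μ)
    (hq0 : 0 ≤ edgeProb α β n) (hq1 : edgeProb α β n ≤ 1) {T : ℝ≥0} (hT : 0 < T) {x p : ℝ}
    (hp : p = (1 - Real.exp (-((updateRate α β n).toNNReal * T))) * edgeProb α β n)
    (hQ : 0 < componentProb n p x) :
    ∫⁻ ω, componentTime G x ω ∂μ ≤ ENNReal.ofReal (T / componentProb n p x) := by
  classical
  obtain ⟨N, B, hN, hBm, hBq, hBi, hNB, hind, hstate⟩ := hG
  have hex : Real.exp (-((updateRate α β n).toNNReal * T)) ≤ 1 := by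
    rw [Real.exp_le_one_iff, neg_nonpos]; positivity
  have hex0 := Real.exp_pos (-(((updateRate α β n).toNNReal : ℝ) * T))
  have hp0 : 0 ≤ p := hp ▸ mul_nonneg (by linarith) hq0
  have hp1 : p ≤ 1 := hp ▸ mul_le_one₀ (by linarith) hq0 hq1
  set Y : VertexPair n → ℕ → Ω → Bool := fun e j ω =>
    fresh (N e ((j : ℕ) * T) ω) (N e ((j + 1 : ℕ) * T) ω) (fun k => B e k ω) with hYdef
  have hYm : ∀ e j, Measurable (Y e j) := fun e j =>
    measurable_fresh ((hN e).measurable _) ((hN e).measurable _) (hBm e)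
  have hY : ∀ K, ∀ y : Fin K → VertexPair n → Bool,
      μ {ω | ∀ e, ∀ j : Fin K, Y e j ω = y j e} =
        ∏ e, ∏ j, ENNReal.ofReal (bernWeight p (y j e)) := by
    intro K y
    let Φ : (ℝ≥0 → ℕ) × (ℕ → Bool) → Fin K → Bool := fun x j =>
      fresh (x.1 ((j : ℕ) * T)) (x.1 (((j : ℕ) + 1 : ℕ) * T)) x.2
    have hΦ : Measurable Φ := measurable_pi_lambda _ fun j =>
      measurable_fresh (a := fun x : (ℝ≥0 → ℕ) × (ℕ → Bool) => x.1 ((j : ℕ) * T))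
        (b := fun x => x.1 (((j : ℕ) + 1 : ℕ) * T)) (c := fun k x => x.2 k)
        ((measurable_pi_apply _).comp measurable_fst)
        ((measurable_pi_apply _).comp measurable_fst)
        fun k => (measurable_pi_apply _).comp measurable_snd
    have h := (hind.comp (fun _ => Φ) fun _ => hΦ).measure_inter_preimage_eq_mul Finset.univ
      (sets := fun e => {fun j => y j e}) (fun e _ => measurableSet_singleton _)
    have hset : {ω | ∀ e, ∀ j : Fin K, Y e j ω = y j e} =
        ⋂ e ∈ (Finset.univ : Finset (VertexPair n)),
          (Φ ∘ fun ω => ((fun t : ℝ≥0 => N e t ω), (fun k : ℕ => B e k ω))) ⁻¹'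
            {fun j => y j e} := by
      ext ω
      simp [Φ, hYdef, funext_iff]
    rw [hset]
    refine h.trans (Finset.prod_congr rfl fun e _ => ?_)
    rw [hp, ← measure_fresh (hN e) (hBm e) (hBi e) hq0 hq1 (hBq e) (hNB e) T K fun j => y j e]
    congr 1
    ext ω
    simp [Φ, funext_iff]
  set F : ℕ → Set Ω := fun K =>
    {ω | ∀ j < K, ¬ HasComponentOfSize (configGraph fun e => Y e j ω) x} with hF
  have hFm : ∀ K, MeasurableSet (F K) := fun K => by
    have : F K = (fun ω (j : Fin K) (e : VertexPair n) => Y e j ω) ⁻¹'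
        {y | ∀ j, ¬ HasComponentOfSize (configGraph (y j)) x} := by
      ext ω
      exact ⟨fun h j => h j j.2, fun h j hj => h ⟨j, hj⟩⟩
    rw [this]
    have hm : Measurable fun ω (j : Fin K) (e : VertexPair n) => Y e j ω :=
      measurable_pi_lambda _ fun j => measurable_pi_lambda _ fun e => hYm e j
    exact hm (Set.toFinite _).measurableSet
  -- Tail-sum formula: `F K` says that the first `K` blocks fail, so the sum is `T` times the index
  -- of the first successful block, counted from one.
  have hbound : ∀ᵐ ω ∂μ, componentTime G x ω ≤
      ∑' K, (F K).indicator (fun _ => (T : ℝ≥0∞)) ω := by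
    filter_upwards [hstate] with ω hω
    by_cases hgood : ∃ j, HasComponentOfSize (configGraph fun e => Y e j ω) x
    · have hj := Nat.find_spec hgood
      have hmin := fun i => Nat.find_min hgood (m := i)
      set j := Nat.find hgood
      have hle : (configGraph fun e => Y e j ω) ≤ G ((j + 1 : ℕ) * T) ω := by
        intro a b hab
        obtain ⟨hd, hab⟩ := configGraph_adj.1 hab
        rw [← SimpleGraph.mem_edgeSet, hω _ ⟨s(a, b), hd⟩]
        simp only [hYdef, fresh, Bool.and_eq_true, decide_eq_true_eq] at hab
        -- A fresh pair has been updated at least once, so its state is the result with index `m`,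
        -- not the initial state.
        obtain ⟨m, hm⟩ := Nat.exists_eq_succ_of_ne_zero (Nat.ne_of_gt (Nat.zero_lt_of_lt hab.1))
        rw [hm] at hab ⊢
        exact hab.2
      calc componentTime G x ω ≤ (((j + 1 : ℕ) * T : ℝ≥0) : ℝ≥0∞) :=
            componentTime_le (hj.mono hle)
        _ = ∑ K ∈ Finset.range (j + 1), (F K).indicator (fun _ => (T : ℝ≥0∞)) ω := by
            rw [Finset.sum_congr rfl fun K hK => Set.indicator_of_mem (s := F K) (fun i hi =>
              hmin i (lt_of_lt_of_le hi (Nat.lt_succ_iff.1 (Finset.mem_range.1 hK)))) _]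
            simp
        _ ≤ _ := ENNReal.sum_le_tsum _
    -- If no block succeeds, the sum is infinite because `T` is positive.
    · push Not at hgood
      have : ∀ K, (F K).indicator (fun _ => (T : ℝ≥0∞)) ω = T := fun K =>
        Set.indicator_of_mem (s := F K) (fun i _ => hgood i) _
      simp only [this]
      rw [ENNReal.tsum_const_eq_top_of_ne_zero (by simpa using hT.ne')]
      exact le_top
  calc ∫⁻ ω, componentTime G x ω ∂μ
      ≤ ∫⁻ ω, ∑' K, (F K).indicator (fun _ => (T : ℝ≥0∞)) ω ∂μ := lintegral_mono_ae hbound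
    _ = ∑' K, ∫⁻ ω, (F K).indicator (fun _ => (T : ℝ≥0∞)) ω ∂μ :=
        lintegral_tsum fun K => (measurable_const.indicator (hFm K)).aemeasurable
    _ = ∑' K, T * μ (F K) := by
        congr 1
        funext K
        rw [lintegral_indicator_const (hFm K)]
    _ ≤ ∑' K, T * ENNReal.ofReal (1 - componentProb n p x) ^ K := by
        refine ENNReal.tsum_le_tsum fun K => ?_
        gcongr
        exact measure_forall_not_hasComponentOfSize_le hp0 hp1 K (hY K)
    _ = T * (1 - ENNReal.ofReal (1 - componentProb n p x))⁻¹ := by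
        rw [ENNReal.tsum_mul_left, ENNReal.tsum_geometric]
    _ = ENNReal.ofReal (T / componentProb n p x) := by
        have h1 : 0 ≤ 1 - componentProb n p x := by
          rw [← sum_not_hasComponentOfSize]
          exact Finset.sum_nonneg fun z _ => Finset.prod_nonneg fun e _ =>
            bernWeight_nonneg hp0 hp1 _
        rw [← ENNReal.ofReal_one, ← ENNReal.ofReal_sub _ h1, sub_sub_cancel,
          ENNReal.ofReal_div_of_pos hQ, ENNReal.ofReal_coe_nnreal, div_eq_mul_inv]

end Blocks

/-! ### Asymptotics of the probability of a large component -/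

theorem pow_self_mul_exp_neg_le_factorial (m : ℕ) :
    (m : ℝ) ^ m * Real.exp (-m) ≤ m.factorial := by
  have h := Real.pow_div_factorial_le_exp (m : ℝ) (Nat.cast_nonneg m) m
  rw [div_le_iff₀ (by positivity)] at h
  rw [Real.exp_neg, ← div_eq_mul_inv, div_le_iff₀ (Real.exp_pos _)]
  linarith

theorem factorial_le_mul_pow_self_mul_exp_neg (m : ℕ) :
    (m.factorial : ℝ) ≤ Real.exp 1 * (m + 1) * (m ^ m * Real.exp (-m)) := by
  -- For positive `m` the induction gives the factor `m`; weakening it to `m + 1` includes `m = 0`.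
  suffices H : ∀ m : ℕ, ((m + 1).factorial : ℝ) ≤
      Real.exp 1 * (m + 1 : ℕ) * ((m + 1 : ℕ) ^ (m + 1) * Real.exp (-(m + 1 : ℕ))) by
    cases m with
    | zero => simp
    | succ m =>
      refine (H m).trans ?_
      gcongr
      linarith
  intro m
  induction m with
  | zero => simp [← Real.exp_add]
  | succ m ih =>
    set a : ℝ := ((m + 1 : ℕ) : ℝ) with ha
    have ha0 : 0 < a := by rw [ha]; positivity
    have hs : ((m + 1 + 1 : ℕ) : ℝ) = a + 1 := by rw [ha]; push_cast; ring
    have h1 : a / (a + 1) ≤ Real.exp (-(1 / (a + 1))) := by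
      have := Real.add_one_le_exp (-(1 / (a + 1)))
      refine le_trans (le_of_eq ?_) this
      field_simp
      ring
    have h2 : (a / (a + 1)) ^ (m + 1 + 1) ≤ Real.exp (-1) := by
      refine (pow_le_pow_left₀ (by positivity) h1 _).trans (le_of_eq ?_)
      rw [← Real.exp_nat_mul, hs]
      congr 1
      field_simp
    rw [div_pow, div_le_iff₀ (by positivity)] at h2
    rw [Nat.factorial_succ, Nat.cast_mul, hs]
    calc (a + 1) * ((m + 1).factorial : ℝ)
        ≤ (a + 1) * (Real.exp 1 * a * (a ^ (m + 1) * Real.exp (-a))) := by gcongr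
      _ = (a + 1) * Real.exp 1 * Real.exp (-a) * a ^ (m + 1 + 1) := by ring
      _ ≤ (a + 1) * Real.exp 1 * Real.exp (-a) * (Real.exp (-1) * (a + 1) ^ (m + 1 + 1)) := by
          gcongr
      _ = _ := by
          rw [neg_add, Real.exp_add (-a)]; ring

theorem one_sub_le_exp_neg_sub_sq {x : ℝ} (h0 : 0 ≤ x) (h1 : x ≤ 1) :
    1 - x ≤ Real.exp (-(x + x ^ 2 / 2)) := by
  rcases h1.eq_or_lt with rfl | h1
  · simpa using (Real.exp_pos _).le
  have hs := Real.hasSum_pow_div_log_of_abs_lt_one (x := x) (by rw [abs_of_nonneg h0]; exact h1)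
  have h2 := sum_le_hasSum (Finset.range 2) (fun i _ => by positivity) hs
  rw [← Real.log_le_iff_le_exp (by linarith)]
  norm_num [Finset.sum_range_succ] at h2
  linarith

/-- Crude Stirling bounds on the three factorials. With `x = k / n`, the exponent is `(n - k) * (x +
x ^ 2 / 2)`, from the first two terms of `-log (1 - x)`. -/
theorem le_choose_mul_pow {n k : ℕ} (hk : k ≤ n) (hn : 0 < n) :
    Real.exp (k - (k : ℝ) ^ 2 / (2 * n) - (k : ℝ) ^ 3 / (2 * n ^ 2)) * Real.exp (-2) /
      ((n : ℝ) + 1) ^ 2 ≤ n.choose k * ((k : ℝ) / n) ^ k := by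
  obtain ⟨m, rfl⟩ := Nat.exists_eq_add_of_le hk
  set n : ℕ := k + m with hnd
  have hn0 : (0 : ℝ) < n := by exact_mod_cast hn
  have hkn : (k : ℝ) ≤ n := by exact_mod_cast hk
  have hmn : (m : ℝ) ≤ n := by exact_mod_cast Nat.le_add_left m k
  have hm : (m : ℝ) = n - k := by rw [hnd]; push_cast; ring
  set x : ℝ := k / n with hx
  have hx0 : 0 ≤ x := by positivity
  have hx1 : x ≤ 1 := (div_le_one hn0).2 hkn
  have hmm : (m : ℝ) ^ m ≤ n ^ m * Real.exp (-(m * (x + x ^ 2 / 2))) := by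
    have h1 : (m : ℝ) = n * (1 - x) := by rw [hm, hx]; field_simp
    calc (m : ℝ) ^ m = (n * (1 - x)) ^ m := by rw [← h1]
      _ ≤ (n * Real.exp (-(x + x ^ 2 / 2))) ^ m :=
          pow_le_pow_left₀ (mul_nonneg hn0.le (by linarith))
            (mul_le_mul_of_nonneg_left (one_sub_le_exp_neg_sub_sq hx0 hx1) hn0.le) _
      _ = _ := by rw [mul_pow, ← Real.exp_nat_mul, mul_neg]
  have hE : (k : ℝ) - (k : ℝ) ^ 2 / (2 * n) - (k : ℝ) ^ 3 / (2 * n ^ 2) = m * (x + x ^ 2 / 2) := by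
    rw [hm, hx]; field_simp; ring
  have hch : (n.choose k : ℝ) * (k.factorial * m.factorial) = n.factorial := by
    rw [← Nat.choose_mul_factorial_mul_factorial hk, show n - k = m by omega]
    push_cast
    ring
  have hfn := pow_self_mul_exp_neg_le_factorial n
  have hfk := factorial_le_mul_pow_self_mul_exp_neg k
  have hfm := factorial_le_mul_pow_self_mul_exp_neg m
  have hprod : (k.factorial : ℝ) * m.factorial ≤
      Real.exp 2 * (n + 1) ^ 2 * (k ^ k * n ^ m) * Real.exp (-(m * (x + x ^ 2 / 2))) *
        Real.exp (-n) := by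
    calc (k.factorial : ℝ) * m.factorial
        ≤ (Real.exp 1 * (n + 1) * (k ^ k * Real.exp (-k))) *
          (Real.exp 1 * (n + 1) *
            ((n ^ m * Real.exp (-(m * (x + x ^ 2 / 2)))) * Real.exp (-m))) := by
          refine mul_le_mul (hfk.trans ?_) (hfm.trans ?_) (by positivity) (by positivity)
          · gcongr
          · gcongr
      _ = _ := by
          rw [show (2 : ℝ) = 1 + 1 by norm_num, Real.exp_add,
            show -(n : ℝ) = -k + -m by rw [hm]; ring, Real.exp_add (-(k : ℝ))]
          ring
  rw [hE]
  have h3 : (n : ℝ) ^ n * Real.exp (-n) ≤ n.choose k * (Real.exp 2 * (n + 1) ^ 2 *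
      (k ^ k * n ^ m) * Real.exp (-(m * (x + x ^ 2 / 2))) * Real.exp (-n)) :=
    hfn.trans (by rw [← hch]; gcongr)
  have h4 : (n : ℝ) ^ n = n ^ k * n ^ m := by rw [← pow_add]
  have h5 : (n : ℝ) ^ k ≤ n.choose k * (Real.exp 2 * (n + 1) ^ 2 * k ^ k *
      Real.exp (-(m * (x + x ^ 2 / 2)))) := by
    refine le_of_mul_le_mul_right (a := (n : ℝ) ^ m * Real.exp (-n)) ?_ (by positivity)
    calc _ = (n : ℝ) ^ n * Real.exp (-n) := by rw [h4]; ring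
      _ ≤ _ := h3
      _ = _ := by ring
  have h6 : Real.exp (-(m * (x + x ^ 2 / 2))) * Real.exp (m * (x + x ^ 2 / 2)) = 1 := by
    rw [← Real.exp_add]; simp
  have h7 : Real.exp (-2) * Real.exp 2 = 1 := by rw [← Real.exp_add]; simp
  have hxk : x ^ k = (k : ℝ) ^ k / n ^ k := by rw [hx, div_pow]
  rw [hxk, div_le_iff₀ (by positivity), ← mul_div_assoc, div_mul_eq_mul_div,
    le_div_iff₀ (by positivity)]
  calc Real.exp (m * (x + x ^ 2 / 2)) * Real.exp (-2) * (n : ℝ) ^ k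
      ≤ Real.exp (m * (x + x ^ 2 / 2)) * Real.exp (-2) * (n.choose k *
        (Real.exp 2 * (n + 1) ^ 2 * k ^ k * Real.exp (-(m * (x + x ^ 2 / 2))))) := by gcongr
    _ = (Real.exp (-(m * (x + x ^ 2 / 2))) * Real.exp (m * (x + x ^ 2 / 2))) *
        (Real.exp (-2) * Real.exp 2) * (n.choose k * k ^ k * (n + 1) ^ 2) := by ring
    _ = _ := by rw [h6, h7]; ring

/-- The number of pairs touching a `k`-set, divided by `n - 1`, is at most `k - k ^ 2 / (2 n) + 2`,
and `1 - 1 / n` is at least `exp (-1 / (n - 1))`. This exponent matches the leading terms of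
`le_choose_mul_pow`. -/
theorem exp_le_one_sub_inv_pow {n k : ℕ} (hk : k ≤ n) (hn : 2 ≤ n) :
    Real.exp (-(k - (k : ℝ) ^ 2 / (2 * n)) - 2) ≤
      (1 - 1 / (n : ℝ)) ^ (n.choose 2 - (n - k).choose 2) := by
  have hn2 : (2 : ℝ) ≤ n := by exact_mod_cast hn
  have hkn : (k : ℝ) ≤ n := by exact_mod_cast hk
  have hk0 : (0 : ℝ) ≤ k := Nat.cast_nonneg k
  have hbase : Real.exp (-(1 / ((n : ℝ) - 1))) ≤ 1 - 1 / (n : ℝ) := by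
    have h1 := Real.add_one_le_exp (1 / ((n : ℝ) - 1))
    rw [Real.exp_neg, inv_le_comm₀ (Real.exp_pos _) (by
      rw [sub_pos, div_lt_one (by linarith)]; linarith)]
    refine le_trans (le_of_eq ?_) h1
    have : (n : ℝ) - 1 ≠ 0 := by linarith
    field_simp
    ring
  refine le_trans ?_ (pow_le_pow_left₀ (Real.exp_pos _).le hbase _)
  rw [← Real.exp_nat_mul, Real.exp_le_exp,
    Nat.cast_sub (Nat.choose_le_choose 2 (Nat.sub_le n k)), Nat.cast_choose_two,
    Nat.cast_choose_two, Nat.cast_sub hk]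
  have hd : (0 : ℝ) < n - 1 := by linarith
  have key : ((n : ℝ) * (n - 1) / 2 - (n - k) * (n - k - 1) / 2) ≤
      (k - (k : ℝ) ^ 2 / (2 * n) + 2) * (n - 1) := by
    have h1 : (k : ℝ) ^ 2 / (2 * n) * n = k ^ 2 / 2 := by field_simp
    have h2 : 0 ≤ (k : ℝ) ^ 2 / (2 * n) := by positivity
    nlinarith
  rw [mul_neg, mul_one_div]
  have := (div_le_iff₀ hd).2 key
  linarith

/-- The probability that the random graph with edge probability `p` in `[c / n, 1 / n]` has a
component of size at least `x ≤ k` is at least `c ^ n * exp (-k ^ 3 / (2 n ^ 2))`, up to a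
polynomial factor. -/
theorem le_componentProb {n k : ℕ} (hk0 : 0 < k) (hk : k ≤ n) (hn : 2 ≤ n) {c p x : ℝ}
    (hc0 : 0 ≤ c) (hc1 : c ≤ 1) (hcp : c / n ≤ p) (hp : p ≤ 1 / n) (hx : x ≤ k) :
    Real.exp (-4) * c ^ n * Real.exp (-((k : ℝ) ^ 3 / (2 * n ^ 2))) / (n * ((n : ℝ) + 1) ^ 2) ≤
      componentProb n p x := by
  have hn2 : (2 : ℝ) ≤ n := by exact_mod_cast hn
  have hkn : (k : ℝ) ≤ n := by exact_mod_cast hk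
  have hn1 : 1 / (n : ℝ) ≤ 1 := by rw [div_le_one (by linarith)]; linarith
  have hp0 : 0 ≤ p := le_trans (by positivity) hcp
  have h := le_card_mul_sum_hasComponentOfSize (n := n) hp0 (hp.trans hn1) hk0 hx
  have hcomp : n.choose k * (k : ℝ) ^ (k - 1) *
      (p ^ (k - 1) * (1 - p) ^ (n.choose 2 - (n - k).choose 2)) ≤ n * componentProb n p x := h
  set Q := n.choose 2 - (n - k).choose 2
  rw [← div_div, div_right_comm, div_le_iff₀ (by linarith), mul_comm _ (n : ℝ)]
  refine le_trans ?_ hcomp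
  have h1 := le_choose_mul_pow hk (by omega)
  have h2 := exp_le_one_sub_inv_pow hk hn
  have h3 : c ^ n ≤ c ^ k := pow_le_pow_of_le_one hc0 hc1 hk
  have hkc : (k : ℝ) / n * c ≤ 1 := mul_le_one₀ ((div_le_one (by linarith)).2 hkn) hc0 hc1
  -- A tree has one edge fewer than vertices; the spare factor `k / n * c` is at most one and is
  -- dropped.
  have h4 : ((k : ℝ) / n) ^ k * c ^ k ≤ (k : ℝ) ^ (k - 1) * p ^ (k - 1) := by
    rw [← mul_pow, ← mul_pow]
    calc ((k : ℝ) / n * c) ^ k ≤ ((k : ℝ) / n * c) ^ (k - 1) :=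
          pow_le_pow_of_le_one (by positivity) hkc (Nat.sub_le _ _)
      _ ≤ (k * p) ^ (k - 1) := by
          refine pow_le_pow_left₀ (by positivity) ?_ _
          calc (k : ℝ) / n * c = k * (c / n) := by ring
            _ ≤ k * p := by gcongr
  have h5 : (1 - 1 / (n : ℝ)) ^ Q ≤ (1 - p) ^ Q :=
    pow_le_pow_left₀ (by linarith) (by linarith) _
  calc Real.exp (-4) * c ^ n * Real.exp (-((k : ℝ) ^ 3 / (2 * n ^ 2))) / ((n : ℝ) + 1) ^ 2
      = (Real.exp (k - (k : ℝ) ^ 2 / (2 * n) - (k : ℝ) ^ 3 / (2 * n ^ 2)) * Real.exp (-2) /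
          ((n : ℝ) + 1) ^ 2) * c ^ n * Real.exp (-(k - (k : ℝ) ^ 2 / (2 * n)) - 2) := by
        have : Real.exp (-4) * Real.exp (-((k : ℝ) ^ 3 / (2 * n ^ 2))) =
            Real.exp (k - (k : ℝ) ^ 2 / (2 * n) - (k : ℝ) ^ 3 / (2 * n ^ 2)) * Real.exp (-2) *
              Real.exp (-(k - (k : ℝ) ^ 2 / (2 * n)) - 2) := by
          rw [← Real.exp_add, ← Real.exp_add, ← Real.exp_add]
          congr 1
          ring
        linear_combination (c ^ n / ((n : ℝ) + 1) ^ 2) * this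
    _ ≤ (n.choose k * ((k : ℝ) / n) ^ k) * c ^ k * (1 - p) ^ Q :=
        mul_le_mul (mul_le_mul h1 h3 (by positivity) (by positivity)) (h2.trans h5)
          (by positivity) (by positivity)
    _ = n.choose k * (((k : ℝ) / n) ^ k * c ^ k) * (1 - p) ^ Q := by ring
    _ ≤ n.choose k * ((k : ℝ) ^ (k - 1) * p ^ (k - 1)) * (1 - p) ^ Q := by
        gcongr
        exact pow_nonneg (by linarith) _
    _ = _ := by ring

/-! ### The critical case and the choice of constants -/

theorem edgeProb_self {α : ℝ} (hα : 0 < α) {n : ℕ} (hn : 0 < n) : edgeProb α α n = 1 / n := by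
  have : (0 : ℝ) < n := by exact_mod_cast hn
  rw [edgeProb, show α + ((n : ℝ) - 1) * α = α * n by ring]
  field_simp

theorem le_updateRate {α : ℝ} (hα : 0 < α) {n : ℕ} (hn : 1 ≤ n) : α ≤ updateRate α α n := by
  have : (1 : ℝ) ≤ n := by exact_mod_cast hn
  have : 0 ≤ α / ((n : ℝ) - 1) := div_nonneg hα.le (by linarith)
  rw [updateRate]
  linarith

/-- Multiplied by `n ^ (1/2)`, the left side is at most `(n + 1) ^ 4`, which the fourth term of the
series of `exp (a * (n + 1))` controls. -/
theorem poly_le_mul_exp {a : ℝ} (ha : 0 < a) {n : ℕ} (hn : 0 < n) :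
    (n : ℝ) * ((n : ℝ) + 1) ^ 2 ≤
      24 * (a⁻¹) ^ 4 * Real.exp a * (n : ℝ) ^ (-(1 / 2) : ℝ) * Real.exp (n * a) := by
  have hn1 : (1 : ℝ) ≤ n := by exact_mod_cast hn
  have h1 := Real.pow_div_factorial_le_exp (a * (n + 1)) (by positivity) 4
  have h2 : ((n : ℝ) + 1) ^ 4 ≤ 24 * (a⁻¹) ^ 4 * Real.exp a * Real.exp (n * a) := by
    rw [show a * ((n : ℝ) + 1) = a + n * a by ring, Real.exp_add,
      div_le_iff₀ (by positivity), show a + n * a = a * ((n : ℝ) + 1) by ring, mul_pow] at h1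
    norm_num [Nat.factorial] at h1
    calc ((n : ℝ) + 1) ^ 4 = (a⁻¹) ^ 4 * (a ^ 4 * (n + 1) ^ 4) := by field_simp
      _ ≤ (a⁻¹) ^ 4 * (Real.exp a * Real.exp (n * a) * 24) := by gcongr
      _ = _ := by ring
  have h3 : (n : ℝ) ^ (1 / 2 : ℝ) ≤ n := by
    calc (n : ℝ) ^ (1 / 2 : ℝ) ≤ (n : ℝ) ^ (1 : ℝ) :=
          Real.rpow_le_rpow_of_exponent_le hn1 (by norm_num)
      _ = n := Real.rpow_one _
  have h4 : (n : ℝ) ^ (1 / 2 : ℝ) * (n : ℝ) ^ (-(1 / 2) : ℝ) = 1 := by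
    rw [← Real.rpow_add (by linarith)]; simp
  have h5 : (0 : ℝ) < (n : ℝ) ^ (-(1 / 2) : ℝ) := Real.rpow_pos_of_pos (by linarith) _
  calc (n : ℝ) * ((n : ℝ) + 1) ^ 2
      = (n : ℝ) ^ (-(1 / 2) : ℝ) * ((n : ℝ) ^ (1 / 2 : ℝ) * (n * (n + 1) ^ 2)) := by
        linear_combination (-((n : ℝ) * (n + 1) ^ 2)) * h4
    _ ≤ (n : ℝ) ^ (-(1 / 2) : ℝ) * ((n + 1) * ((n + 1) * (n + 1) ^ 2)) := by
        gcongr <;> linarith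
    _ = (n : ℝ) ^ (-(1 / 2) : ℝ) * (n + 1) ^ 4 := by ring
    _ ≤ (n : ℝ) ^ (-(1 / 2) : ℝ) * (24 * (a⁻¹) ^ 4 * Real.exp a * Real.exp (n * a)) := by gcongr
    _ = _ := by ring

theorem lintegral_componentTime_self_le {α ε ε' : ℝ} (hα : 0 < α) (hε : 0 < ε) (hε1 : ε < 1)
    {T : ℝ≥0} (hT : 0 < T) {a : ℝ} (ha : 1 - Real.exp (-(α * T)) = Real.exp (-a))
    {n : ℕ} (hn : 2 ≤ n) (hnε : 1 ≤ n * (ε' - ε)) {Ω : Type*} [MeasurableSpace Ω] {μ : Measure Ω}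
    [IsProbabilityMeasure μ] {G : ℝ≥0 → Ω → SimpleGraph (Fin n)} {G₀ : SimpleGraph (Fin n)}
    (hG : IsDynamicERGraph α α G₀ G μ) :
    ∫⁻ ω, componentTime G (ε * n) ω ∂μ ≤ ENNReal.ofReal
      (T * Real.exp 4 * (n * ((n : ℝ) + 1) ^ 2) * Real.exp (n * (a + ε' ^ 3 / 2))) := by
  have hn2 : (2 : ℝ) ≤ n := by exact_mod_cast hn
  have hn0 : (0 : ℝ) < n := by linarith
  have hn1 : 1 / (n : ℝ) ≤ 1 := by rw [div_le_one hn0]; linarith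
  have hedge := edgeProb_self hα (show 0 < n by omega)
  have hrate : α ≤ ((updateRate α α n).toNNReal : ℝ) :=
    (le_updateRate hα (by omega)).trans (Real.le_coe_toNNReal _)
  set p := (1 - Real.exp (-((updateRate α α n).toNNReal * T))) * edgeProb α α n with hp
  set k := ⌈ε * n⌉₊ with hk
  have hεn : 0 < ε * n := by positivity
  have hk0 : 0 < k := Nat.ceil_pos.2 hεn
  have hkn : k ≤ n := Nat.ceil_le.2 (by nlinarith)
  -- The gap between `ε` and `ε'` absorbs the rounding in `k`.
  have hkε : (k : ℝ) ≤ ε' * n := by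
    have := (Nat.ceil_lt_add_one hεn.le).le
    nlinarith
  have hc1 : Real.exp (-a) ≤ 1 := by
    rw [← ha]; linarith [Real.exp_pos (-(α * T))]
  have hexp : Real.exp (-((updateRate α α n).toNNReal * T)) ≤ Real.exp (-(α * T)) := by
    gcongr
  have hcp : Real.exp (-a) / n ≤ p := by
    rw [hp, hedge, ← ha, div_eq_mul_one_div]
    gcongr
  have hpn : p ≤ 1 / n := by
    rw [hp, hedge]
    refine mul_le_of_le_one_left (by positivity) ?_
    linarith [Real.exp_pos (-(((updateRate α α n).toNNReal : ℝ) * T))]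
  have hlow := le_componentProb hk0 hkn hn (Real.exp_pos (-a)).le hc1 hcp hpn (Nat.le_ceil (ε * n))
  have hQ : 0 < componentProb n p (ε * n) := lt_of_lt_of_le (by positivity) hlow
  refine (lintegral_componentTime_le hG (by rw [hedge]; positivity) (by rw [hedge]; exact hn1) hT
    hp hQ).trans (ENNReal.ofReal_le_ofReal ?_)
  have hk3 : (k : ℝ) ^ 3 / (2 * n ^ 2) ≤ n * (ε' ^ 3 / 2) := by
    rw [div_le_iff₀ (by positivity)]
    calc (k : ℝ) ^ 3 ≤ (ε' * n) ^ 3 := by gcongr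
      _ = _ := by ring
  rw [div_le_iff₀ hQ]
  have hpoly : 0 < (n : ℝ) * ((n : ℝ) + 1) ^ 2 := by positivity
  calc (T : ℝ) = T * Real.exp (4 + n * (a + ε' ^ 3 / 2) +
        (-4 + n * (-a) + -(n * (ε' ^ 3 / 2)))) := by
        rw [show (4 : ℝ) + n * (a + ε' ^ 3 / 2) + (-4 + n * (-a) + -(n * (ε' ^ 3 / 2))) = 0 by ring,
          Real.exp_zero, mul_one]
    _ = T * Real.exp 4 * (n * ((n : ℝ) + 1) ^ 2) * Real.exp (n * (a + ε' ^ 3 / 2)) *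
        (Real.exp (-4) * Real.exp (-a) ^ n * Real.exp (-(n * (ε' ^ 3 / 2))) /
          (n * ((n : ℝ) + 1) ^ 2)) := by
        rw [← Real.exp_nat_mul, Real.exp_add, Real.exp_add, Real.exp_add, Real.exp_add]
        field_simp
    _ ≤ T * Real.exp 4 * (n * ((n : ℝ) + 1) ^ 2) * Real.exp (n * (a + ε' ^ 3 / 2)) *
        (Real.exp (-4) * Real.exp (-a) ^ n * Real.exp (-((k : ℝ) ^ 3 / (2 * n ^ 2))) /
          (n * ((n : ℝ) + 1) ^ 2)) := by gcongr
    _ ≤ _ := by gcongr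

end DynamicER

theorem mainTheorem5 :
    ∃ r : ℝ → ℝ, r =O[𝓝[>] (0 : ℝ)] (fun x => x ^ 3) ∧
      ∀ α : ℝ, 0 < α → ∀ ε ε' : ℝ, 0 < ε → ε < 1 → ε < ε' →
        ∃ (M : ℝ) (n₀ : ℕ), ∀ n : ℕ, n₀ ≤ n →
          ∀ (Ω : Type*) [MeasurableSpace Ω] (μ : Measure Ω) [IsProbabilityMeasure μ]
            (G : ℝ≥0 → Ω → SimpleGraph (Fin n)),
            DynamicER.IsDynamicERGraph α α (⊥ : SimpleGraph (Fin n)) G μ →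
              ∫⁻ ω, DynamicER.componentTime G (ε * n) ω ∂μ ≤
                ENNReal.ofReal (M * (n : ℝ) ^ (-(1 / 2) : ℝ) *
                  Real.exp (n * (ε' ^ 2 / 16 + r ε'))) := by
  refine ⟨fun x => 1 / 2 * x ^ 3, (isBigO_refl _ _).const_mul_left _, ?_⟩
  intro α hα ε ε' hε hε1 hεε'
  have hε' : 0 < ε' := hε.trans hεε'
  -- Half of `ε' ^ 2 / 16`: one `a` is the loss from `c = exp (-a)`, the other absorbs the
  -- polynomial.
  set a : ℝ := ε' ^ 2 / 32 with ha
  have ha0 : 0 < a := by positivity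
  have hea : Real.exp (-a) < 1 := by simpa using ha0
  have hT0 : 0 < -Real.log (1 - Real.exp (-a)) / α :=
    div_pos (neg_pos.2 (Real.log_neg (by linarith) (by linarith [Real.exp_pos (-a)]))) hα
  -- The solution of `1 - exp (-α T) = exp (-a)`; it does not depend on `n`.
  set T : ℝ≥0 := ⟨-Real.log (1 - Real.exp (-a)) / α, hT0.le⟩ with hTdef
  have hT : 0 < T := hT0
  have hTa : 1 - Real.exp (-(α * T)) = Real.exp (-a) := by
    have : -(α * (T : ℝ)) = Real.log (1 - Real.exp (-a)) := by
      change -(α * (-Real.log (1 - Real.exp (-a)) / α)) = _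
      field_simp
    rw [this, Real.exp_log (by linarith)]
    ring
  obtain ⟨n₁, hn₁⟩ := exists_nat_ge (1 / (ε' - ε))
  refine ⟨T * Real.exp 4 * (24 * (a⁻¹) ^ 4 * Real.exp a), max 2 n₁, ?_⟩
  intro n hn Ω _ μ _ G hG
  have hn2 : 2 ≤ n := (le_max_left _ _).trans hn
  have hnε : 1 ≤ n * (ε' - ε) := by
    rw [← div_le_iff₀ (by linarith)]
    exact hn₁.trans (by exact_mod_cast (le_max_right _ _).trans hn)
  refine (DynamicER.lintegral_componentTime_self_le hα hε hε1 hT hTa hn2 hnε hG).trans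
    (ENNReal.ofReal_le_ofReal ?_)
  have hpoly := DynamicER.poly_le_mul_exp ha0 (show 0 < n by omega)
  calc T * Real.exp 4 * (n * ((n : ℝ) + 1) ^ 2) * Real.exp (n * (a + ε' ^ 3 / 2))
      ≤ T * Real.exp 4 * (24 * (a⁻¹) ^ 4 * Real.exp a * (n : ℝ) ^ (-(1 / 2) : ℝ) *
          Real.exp (n * a)) * Real.exp (n * (a + ε' ^ 3 / 2)) := by gcongr
    _ = _ := by
        have : Real.exp (n * (ε' ^ 2 / 16 + 1 / 2 * ε' ^ 3)) =
            Real.exp (n * a) * Real.exp (n * (a + ε' ^ 3 / 2)) := by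
          rw [← Real.exp_add]
          congr 1
          rw [ha]
          ring
        rw [this]
        ring
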